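/- Let $2\le k\le n-2$. Let $\overline X(k,n)$ be the set of complex $k\times n$ matrices of rank $k$ with no zero column, modulo left multiplication by $SL(k,\mathbb C)$ and rescaling of the columns by $(\mathbb C^*)^n$. For a $k\times n$ matrix $M$ denote by $p_{i_1,\ldots,i_k}$ its minor on the columns $i_1,\ldots,i_k$, column indices being taken modulo $n$. The planar kinematics (PK) potential function is $$\mathcal S^{(PK)}_{k,n}=\sum_{i=1}^n\log\left(\frac{p_{i,i+1,\ldots,i+k-2,i+k-1}}{p_{i,i+1,\ldots,i+k-2,i+k}}\right),$$ defined, up to additive constants coming from the choice of local branches of the logarithms, at those points of $\overline X(k,n)$ at which none of the $2n$ minors $p_{i,\ldots,i+k-2,i+k-1}$, $p_{i,\ldots,i+k-2,i+k}$ vanishes. A critical point of $\mathcal S^{(PK)}_{k,n}$ is a point of $\overline X(k,n)$ where none of these minors vanishes and where the differential of $\mathcal S^{(PK)}_{k,n}$, as a function of the entries of a representing matrix, is zero. Then $\mathcal S^{(PK)}_{k,n}$ has only finitely many critical points in $\overline X(k,n)$, and their number is at most $\mathcal N_{k,n}$, the number of binary Lyndon words with $k$ ones and $n-k$ zeros (words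 strictly smaller, in lexicographic order, than all their $n-1$ nontrivial cyclic rotations). Moreover $$\mathcal N_{k,n}=\frac1n\sum_{d\mid\gcd(k,n)}\mu(d)\binom{n/d}{k/d},$$ where $\mu$ is the Möbius function. -/

import Mathlib

/-- `k × n` complex matrices, with the columns labelled by the integers modulo `n`, so that
arithmetic of column labels is automatically cyclic. -/
abbrev PKMatrix (k n : ℕ) : Type := Matrix (Fin k) (ZMod n) ℂ

/-- The two matrices differ by the left action of `SL(k)` and by the rescaling of the columns
by nonzero complex numbers. -/
def pkEquiv {k n : ℕ} [NeZero n] (M N : PKMatrix k n) : Prop :=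
  ∃ (g : Matrix.SpecialLinearGroup (Fin k) ℂ) (t : ZMod n → ℂˣ),
    N = (g : Matrix (Fin k) (Fin k) ℂ) * M * Matrix.diagonal (fun j => (t j : ℂ))

theorem pkEquiv_equivalence {k n : ℕ} [NeZero n] :
    Equivalence (pkEquiv : PKMatrix k n → PKMatrix k n → Prop) where
  refl M := ⟨1, 1, by simp⟩
  symm := by
    rintro M N ⟨g, t, rfl⟩
    refine ⟨g⁻¹, t⁻¹, ?_⟩
    have h1 : ((g⁻¹ : Matrix.SpecialLinearGroup (Fin k) ℂ) : Matrix (Fin k) (Fin k) ℂ) *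
        (g : Matrix (Fin k) (Fin k) ℂ) = 1 := by
      rw [← Matrix.SpecialLinearGroup.coe_mul, inv_mul_cancel, Matrix.SpecialLinearGroup.coe_one]
    have h2 : Matrix.diagonal (fun j => (t j : ℂ)) *
        Matrix.diagonal (fun j => ((t⁻¹) j : ℂ)) = 1 := by
      simp [Matrix.diagonal_mul_diagonal]
    rw [← Matrix.mul_assoc, ← Matrix.mul_assoc, h1, Matrix.one_mul, Matrix.mul_assoc, h2,
      Matrix.mul_one]
  trans := by
    rintro M N P ⟨g, t, rfl⟩ ⟨g', t', rfl⟩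
    refine ⟨g' * g, t * t', ?_⟩
    have h2 : Matrix.diagonal (fun j => (t j : ℂ)) *
        Matrix.diagonal (fun j => (t' j : ℂ)) = Matrix.diagonal (fun j => ((t * t') j : ℂ)) := by
      simp [Matrix.diagonal_mul_diagonal]
    rw [← h2, Matrix.SpecialLinearGroup.coe_mul]
    simp only [Matrix.mul_assoc]

/-- The matrices representing a configuration of `n` labelled points that span `ℂℙ^(k-1)`:
maximal rank, and no column identically zero. -/
def PKRep (k n : ℕ) [NeZero n] : Type :=
  {M : PKMatrix k n // M.rank = k ∧ ∀ j : ZMod n, ∃ a : Fin k, M a j ≠ 0}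

instance pkSetoid (k n : ℕ) [NeZero n] : Setoid (PKRep k n) where
  r M N := pkEquiv M.1 N.1
  iseqv := ⟨fun M => pkEquiv_equivalence.refl M.1, fun h => pkEquiv_equivalence.symm h,
    fun h h' => pkEquiv_equivalence.trans h h'⟩

/-- The extended configuration space `X̄(k,n)` of `n` labelled points on `ℂℙ^(k-1)`: the
matrices of maximal rank without zero column, modulo `SL(k)` and the torus `(ℂ*)ⁿ`. -/
def ConfigSpace (k n : ℕ) [NeZero n] : Type := Quotient (pkSetoid k n)

/-- The minor `p_{i, i+1, …, i+k-2, i+k-1}`. The columns are taken in the displayed cyclic order;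
another order changes it by a sign at most, hence each logarithm by a constant. -/
noncomputable def consecMinor {k n : ℕ} (M : PKMatrix k n) (i : ZMod n) : ℂ :=
  (M.submatrix id (fun j : Fin k => i + ((j : ℕ) : ZMod n))).det

/-- The minor `p_{i, i+1, …, i+k-2, i+k}`. -/
noncomputable def skipMinor {k n : ℕ} (M : PKMatrix k n) (i : ZMod n) : ℂ :=
  (M.submatrix id (fun j : Fin k =>
    i + ((if (j : ℕ) + 1 = k then k else (j : ℕ) : ℕ) : ZMod n))).det

/-- The argument of the `i`-th logarithm in the potential. -/
noncomputable def minorRatio {k n : ℕ} (M : PKMatrix k n) (i : ZMod n) : ℂ :=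
  consecMinor M i / skipMinor M i

/-- The locus where the potential is defined: none of the minors in it vanishes. -/
def InPKDomain {k n : ℕ} (M : PKMatrix k n) : Prop :=
  ∀ i : ZMod n, consecMinor M i ≠ 0 ∧ skipMinor M i ≠ 0

/-- The planar kinematics potential `∑ᵢ log (p_{i,…,i+k-2,i+k-1} / p_{i,…,i+k-2,i+k})` at `N`, in
the determination which is holomorphic for `N` near the base matrix `M`: the `i`-th logarithm is
the branch on the plane cut along the ray opposite to `minorRatio M i` that equals the principal
logarithm at `N = M`. Any two local determinations of the potential differ by a constant. -/
noncomputable def pkPotential {k n : ℕ} [NeZero n] (M N : PKMatrix k n) : ℂ :=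
  ∑ i : ZMod n, (Complex.log (minorRatio M i) + Complex.log (minorRatio N i / minorRatio M i))

/-- `M` is a critical point of the potential: it lies in the domain, and the differential
there of the potential, as a function of the matrix entries, vanishes. -/
def IsPKCritical {k n : ℕ} [NeZero n] (M : PKMatrix k n) : Prop :=
  InPKDomain M ∧
    HasFDerivAt (𝕜 := ℂ) (fun A : Fin k → ZMod n → ℂ => pkPotential M (Matrix.of A)) 0
      (fun a j => M a j)

/-- The critical points of the planar kinematics potential in the configuration space. The
potential, up to constants, and its domain are invariant under `SL(k)` and the torus, so this does
not depend on the representative. -/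
def pkCriticalPoints (k n : ℕ) [NeZero n] : Set (ConfigSpace k n) :=
  {x | ∃ M : PKRep k n, (Quotient.mk (pkSetoid k n) M : ConfigSpace k n) = x ∧ IsPKCritical M.1}

/-- A binary word of length `n` is a Lyndon word if it is nonempty and strictly smaller, in
lexicographic order (`false`, the zero, before `true`, the one), than its `n - 1` nontrivial cyclic
rotations. -/
def IsLyndon {n : ℕ} (w : Fin n → Bool) : Prop :=
  0 < n ∧ ∀ j : Fin n, (j : ℕ) ≠ 0 → toLex w < toLex (fun i : Fin n => w (i + j))

/-- The number of binary Lyndon words with `k` ones and `n - k` zeros. -/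
noncomputable def lyndonCount (k n : ℕ) : ℕ :=
  Set.ncard {w : Fin n → Bool | IsLyndon w ∧ (Finset.univ.filter (fun i => w i = true)).card = k}

/-!
Write `v i` for the columns of `M`, set `k = K + 1`, and let `f i` be the functional that vanishes
on `v i, …, v (i + K - 1)` and is `1` on `v (i + K)` (`lastDual`). On the domain of the potential
each column is a combination `v (i + k) = ∑ l < k, c i l • v (i + l)` (`recCoeff`), and the `i`-th
summand of the potential is `-log (c i K)` up to a constant. Its differential in a direction `D` is
`(c i K)⁻¹ * (∑ l, c i l * f i (D (i + l)) - f i (D (i + k)))`, so that perturbing one column at a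
time shows that a matrix is critical only if the functionals `f` satisfy, up to the factors
`c i K`, a recurrence with the same coefficients `c` (`IsPKCritical.lastDual_eq`).

A rescaling of the columns makes all `c i K` equal, and then the recurrences of `v` and of `f` match
exactly. Expanding the numbers `f i (v (i + m))` by either of them and comparing, one finds by
induction that every coefficient `c i l` is independent of `i` (`coeff_const_of_recurrences`). The
columns thus satisfy a recurrence with constant coefficients; as they are `n`-periodic and the first
`k` of them are independent, its characteristic polynomial divides `X ^ n - 1`
(`SatisfiesRec.dvd`), so it is given by a set of `k` distinct `n`-th roots of unity, that is, by a
binary word with `k` ones. The word determines the configuration (`pkEquiv_of_satisfiesRec`), and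
rotating the word only rescales the columns (`exists_scaling_rotate`). If a nontrivial rotation
fixed the word, the sum `c i K` of the roots would vanish, which is excluded on the domain of the
potential. Hence the word is aperiodic and may be rotated to a Lyndon word; this embeds the set of
critical points into the set of Lyndon words.

The count of Lyndon words is Möbius inversion over the period of a word: aperiodic words are the
rotations of Lyndon words, and words of length `n` fixed by the rotation by `n / d` are the
`d`-fold repetitions of words of length `n / d`.
-/

/-! ### Rotations of binary words -/

theorem card_true_comp_equiv {α β : Type*} [Fintype α] [Fintype β] (e : α ≃ β) (w : β → Bool) :
    (Finset.univ.filter (fun i => w (e i) = true)).card =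
      (Finset.univ.filter (fun i => w i = true)).card :=
  Finset.card_equiv e (by simp)

/-- A word is aperiodic if no nontrivial cyclic rotation fixes it. -/
def IsAperiodic {n : ℕ} [NeZero n] (w : Fin n → Bool) : Prop :=
  ∀ j : Fin n, j ≠ 0 → (fun i => w (i + j)) ≠ w

theorem IsLyndon.isAperiodic {n : ℕ} [NeZero n] {w : Fin n → Bool} (hw : IsLyndon w) :
    IsAperiodic w := by
  intro j hj h
  have h1 := hw.2 j (fun h0 => hj (Fin.ext (by simpa using h0)))
  rw [h] at h1
  exact lt_irrefl _ h1

theorem IsAperiodic.rotate {n : ℕ} [NeZero n] {w : Fin n → Bool} (hw : IsAperiodic w)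
    (r : Fin n) : IsAperiodic (fun i => w (i + r)) := by
  intro j hj h
  refine hw j hj (funext fun i => ?_)
  have h1 := congrFun h (i - r)
  simp only [sub_add_cancel] at h1
  rw [← h1]
  congr 1
  abel

/-- The lexicographically least rotation of an aperiodic word is a Lyndon word. -/
theorem IsAperiodic.exists_isLyndon_rotate {n : ℕ} [NeZero n] {w : Fin n → Bool}
    (hw : IsAperiodic w) : ∃ r : Fin n, IsLyndon (fun i => w (i + r)) := by
  obtain ⟨r, hr⟩ := Finite.exists_min (fun r : Fin n => toLex (fun i : Fin n => w (i + r)))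
  refine ⟨r, Nat.pos_of_ne_zero (NeZero.ne n), fun j hj => lt_of_le_of_ne ?_ ?_⟩
  · simpa only [add_assoc] using hr (j + r)
  · intro h
    have hj0 : j ≠ 0 := fun h0 => hj (by simp [h0])
    exact hw.rotate r j hj0 (toLex.injective h).symm

/-- Two Lyndon words which are rotations of each other coincide. -/
theorem IsLyndon.eq_of_rotate {n : ℕ} [NeZero n] {w : Fin n → Bool} {r : Fin n}
    (hw : IsLyndon w) (hr : IsLyndon (fun i => w (i + r))) : r = 0 := by
  by_contra h
  have h1 := hw.2 r (fun h0 => h (Fin.ext (by simpa using h0)))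
  have h2 := hr.2 (-r) (fun h0 => h (by
    have : -r = 0 := Fin.ext (by simpa using h0)
    simpa using this))
  simp only [neg_add_cancel_right] at h2
  exact lt_asymm h1 h2

open Classical in
/-- Each aperiodic word is a rotation, by a unique amount, of a unique Lyndon word. -/
theorem card_aperiodic (k n : ℕ) [NeZero n] :
    (Finset.univ.filter (fun w : Fin n → Bool => IsAperiodic w ∧
      (Finset.univ.filter (fun i => w i = true)).card = k)).card = n * lyndonCount k n := by
  have h0 : lyndonCount k n = (Finset.univ.filter (fun w : Fin n → Bool => IsLyndon w ∧
      (Finset.univ.filter (fun i => w i = true)).card = k)).card := by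
    rw [lyndonCount, ← Set.ncard_coe_finset]
    simp
  have h1 : ∀ s : Finset (Fin n → Bool), n * s.card =
      ((Finset.univ : Finset (Fin n)) ×ˢ s).card := fun s => by simp
  rw [h0, h1]
  symm
  refine Finset.card_bij (fun p _ => fun i => p.2 (i + p.1)) ?_ ?_ ?_
  · rintro ⟨r, w⟩ h
    simp only [Finset.mem_product, Finset.mem_filter, Finset.mem_univ, true_and] at h ⊢
    exact ⟨h.1.isAperiodic.rotate r, (card_true_comp_equiv (Equiv.addRight r) w).trans h.2⟩
  · rintro ⟨r, w⟩ h ⟨r', w'⟩ h' he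
    simp only [Finset.mem_product, Finset.mem_filter, Finset.mem_univ, true_and] at h h'
    have h2 : w' = fun i => w (i + (r - r')) := by
      funext i
      have := congrFun he (i - r')
      simp only [sub_add_cancel] at this
      rw [← this]
      congr 1
      abel
    have h3 : r - r' = 0 := h.1.eq_of_rotate (h2 ▸ h'.1)
    have h4 : r = r' := sub_eq_zero.mp h3
    subst h4
    simp [h2]
  · intro w h
    simp only [Finset.mem_filter, Finset.mem_univ, true_and] at h
    obtain ⟨r, hr⟩ := h.1.exists_isLyndon_rotate
    refine ⟨(-r, fun i => w (i + r)), ?_, ?_⟩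
    · simp only [Finset.mem_product, Finset.mem_filter, Finset.mem_univ, true_and]
      exact ⟨hr, (card_true_comp_equiv (Equiv.addRight r) w).trans h.2⟩
    · simp

/-- Rotation of a word by one letter. -/
def rotateOne {n : ℕ} [NeZero n] (w : Fin n → Bool) : Fin n → Bool := fun i => w (i + 1)

theorem rotateOne_iterate {n : ℕ} [NeZero n] (w : Fin n → Bool) (m : ℕ) :
    rotateOne^[m] w = fun i => w (i + Fin.ofNat n m) := by
  induction m generalizing w with
  | zero => simp
  | succ m ih =>
    rw [Function.iterate_succ_apply, ih]
    funext i
    simp only [rotateOne]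
    congr 1
    apply Fin.ext
    simp [Fin.val_add, add_assoc]

theorem isPeriodicPt_rotateOne {n : ℕ} [NeZero n] (w : Fin n → Bool) :
    Function.IsPeriodicPt rotateOne n w := by
  rw [Function.IsPeriodicPt, Function.IsFixedPt, rotateOne_iterate]
  simp

theorem isAperiodic_iff_minimalPeriod {n : ℕ} [NeZero n] (w : Fin n → Bool) :
    IsAperiodic w ↔ Function.minimalPeriod rotateOne w = n := by
  have hn := Nat.pos_of_ne_zero (NeZero.ne n)
  constructor
  · intro h
    have hle : Function.minimalPeriod rotateOne w ≤ n :=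
      (isPeriodicPt_rotateOne w).minimalPeriod_le hn
    have hpos := (isPeriodicPt_rotateOne w).minimalPeriod_pos hn
    rcases hle.lt_or_eq with hlt | heq
    · exfalso
      have h1 := Function.isPeriodicPt_minimalPeriod rotateOne w
      rw [Function.IsPeriodicPt, Function.IsFixedPt, rotateOne_iterate] at h1
      refine h _ (fun h0 => ?_) h1
      have := congrArg Fin.val h0
      simp [Nat.mod_eq_of_lt hlt] at this
      omega
    · exact heq
  · intro h j hj h1
    have h2 : Function.IsPeriodicPt rotateOne (j : ℕ) w := by
      rw [Function.IsPeriodicPt, Function.IsFixedPt, rotateOne_iterate]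
      simpa using h1
    have hj' : 0 < (j : ℕ) := Nat.pos_of_ne_zero (fun h0 => hj (Fin.ext (by simpa using h0)))
    have := h2.minimalPeriod_le hj'
    have := j.2
    omega

/-! ### Counting the words fixed by a rotation -/

theorem card_words (m j : ℕ) : (Finset.univ.filter (fun u : Fin m → Bool =>
    (Finset.univ.filter (fun i => u i = true)).card = j)).card = m.choose j := by
  have h : m.choose j = ((Finset.univ : Finset (Fin m)).powersetCard j).card := by simp
  rw [h]
  refine Finset.card_bij (fun u _ => Finset.univ.filter (fun i => u i = true)) ?_ ?_ ?_
  · intro u hu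
    simpa [Finset.mem_powersetCard] using hu
  · intro u _ u' _ h
    funext i
    have := congrArg (i ∈ ·) h
    simpa using this
  · intro s hs
    refine ⟨fun i => decide (i ∈ s), ?_, by simp⟩
    simpa [Finset.mem_powersetCard] using hs

/-- A word of length `d * m` which is fixed by the rotation by `m` is the `d`-fold repetition of
a word of length `m`. -/
theorem card_words_of_rotate_eq (d m k : ℕ) [NeZero (d * m)] :
    (Finset.univ.filter (fun w : Fin (d * m) → Bool => rotateOne^[m] w = w ∧
      (Finset.univ.filter (fun i => w i = true)).card = k)).card =
      if d ∣ k then m.choose (k / d) else 0 := by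
  have hdm := NeZero.ne (d * m)
  have hd : 0 < d := Nat.pos_of_ne_zero (left_ne_zero_of_mul hdm)
  have hm : 0 < m := Nat.pos_of_ne_zero (right_ne_zero_of_mul hdm)
  have hle : m ≤ d * m := Nat.le_mul_of_pos_left m hd
  -- `E u` repeats the word `u` periodically.
  let E : (Fin m → Bool) → (Fin (d * m) → Bool) := fun u x => u ⟨x % m, Nat.mod_lt _ hm⟩
  have hones : ∀ u : Fin m → Bool, (Finset.univ.filter (fun i => E u i = true)).card =
      d * (Finset.univ.filter (fun i => u i = true)).card := by
    intro u
    rw [← card_true_comp_equiv finProdFinEquiv (E u)]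
    have : (Finset.univ.filter (fun p : Fin d × Fin m => E u (finProdFinEquiv p) = true)) =
        Finset.univ ×ˢ (Finset.univ.filter (fun i => u i = true)) := by
      ext ⟨x, y⟩
      simp [E, finProdFinEquiv, Nat.mod_eq_of_lt y.2]
    rw [this, Finset.card_product]
    simp
  have hfix : ∀ u, rotateOne^[m] (E u) = E u := by
    intro u
    rw [rotateOne_iterate]
    funext x
    simp only [E]
    congr 1
    apply Fin.ext
    simp [Fin.val_add]
  have hsurj : ∀ w : Fin (d * m) → Bool, rotateOne^[m] w = w → ∃ u, E u = w := by
    intro w hw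
    refine ⟨fun y => w ⟨y, y.2.trans_le hle⟩, funext fun x => ?_⟩
    have h1 : rotateOne^[m * ((x : ℕ) / m)] w = w := by
      rw [Function.iterate_mul]
      exact Function.iterate_fixed hw _
    rw [rotateOne_iterate] at h1
    have h2 := congrFun h1 ⟨x % m, (Nat.mod_lt _ hm).trans_le hle⟩
    simp only [E]
    rw [← h2]
    congr 1
    apply Fin.ext
    simp [Fin.val_add, Nat.mod_add_div, Nat.mod_eq_of_lt x.2]
  have hinj : Function.Injective E := by
    intro u u' h
    funext y
    have := congrFun h ⟨y, y.2.trans_le hle⟩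
    simpa [E, Nat.mod_eq_of_lt y.2] using this
  split_ifs with hk
  · obtain ⟨j, rfl⟩ := hk
    rw [Nat.mul_div_cancel_left _ hd, ← card_words]
    symm
    refine Finset.card_bij (fun u _ => E u) ?_ (fun u _ u' _ h => hinj h) ?_
    · intro u hu
      simp only [Finset.mem_filter, Finset.mem_univ, true_and] at hu ⊢
      exact ⟨hfix u, by rw [hones, hu]⟩
    · intro w hw
      simp only [Finset.mem_filter, Finset.mem_univ, true_and] at hw
      obtain ⟨u, rfl⟩ := hsurj w hw.1
      refine ⟨u, ?_, rfl⟩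
      simp only [Finset.mem_filter, Finset.mem_univ, true_and]
      exact Nat.eq_of_mul_eq_mul_left hd (by rw [← hones, hw.2])
  · rw [Finset.card_eq_zero, Finset.filter_eq_empty_iff]
    rintro w - ⟨hw, hw'⟩
    obtain ⟨u, rfl⟩ := hsurj w hw
    exact hk ⟨_, by rw [← hw', hones]⟩

/-! ### The number of Lyndon words -/

/-- The divisors `d` of `n` with `p ∣ n / d` are the divisors of `n / p`. -/
theorem sum_moebius_dvd_div {n p : ℕ} (hn : n ≠ 0) (hp : p ∣ n) :
    (∑ d ∈ n.divisors, if p ∣ n / d then ArithmeticFunction.moebius d else 0) =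
      if p = n then 1 else 0 := by
  obtain ⟨q, rfl⟩ := hp
  have hp0 : 0 < p := Nat.pos_of_ne_zero (left_ne_zero_of_mul hn)
  have hq0 : q ≠ 0 := right_ne_zero_of_mul hn
  have h1 : (p * q).divisors.filter (fun d => p ∣ p * q / d) = q.divisors := by
    ext d
    simp only [Finset.mem_filter, Nat.mem_divisors]
    constructor
    · rintro ⟨⟨⟨e, he⟩, -⟩, h⟩
      have hd0 : 0 < d := Nat.pos_of_ne_zero (by rintro rfl; simp at he; omega)
      rw [he, Nat.mul_div_cancel_left _ hd0] at h
      obtain ⟨f, rfl⟩ := h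
      refine ⟨⟨f, Nat.eq_of_mul_eq_mul_left hp0 ?_⟩, hq0⟩
      rw [he]; ring
    · rintro ⟨⟨f, rfl⟩, -⟩
      have hd0 : 0 < d := Nat.pos_of_ne_zero (left_ne_zero_of_mul hq0)
      refine ⟨⟨⟨p * f, by ring⟩, hn⟩, ⟨f, ?_⟩⟩
      rw [show p * (d * f) = d * (p * f) by ring, Nat.mul_div_cancel_left _ hd0]
  rw [← Finset.sum_filter, h1]
  have h2 := congrArg (fun F => F q) ArithmeticFunction.moebius_mul_coe_zeta
  simp only [ArithmeticFunction.coe_mul_zeta_apply, ArithmeticFunction.one_apply] at h2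
  rw [h2]
  congr 1
  simp [hp0.ne']

/-- Möbius inversion over the periods of words. -/
theorem mul_lyndonCount (k n : ℕ) [NeZero n] (hk : k ≠ 0) :
    ((n * lyndonCount k n : ℕ) : ℤ) = ∑ d ∈ (Nat.gcd k n).divisors,
      ArithmeticFunction.moebius d * (Nat.choose (n / d) (k / d) : ℤ) := by
  classical
  have hn := NeZero.ne n
  have h1 : (Nat.gcd k n).divisors = n.divisors.filter (fun d => d ∣ k) := by
    ext d
    simp only [Nat.mem_divisors, Finset.mem_filter, Nat.dvd_gcd_iff]
    have : Nat.gcd k n ≠ 0 := Nat.gcd_ne_zero_left hk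
    tauto
  rw [h1, Finset.sum_filter, ← card_aperiodic, Finset.card_filter, Nat.cast_sum]
  calc _ = ∑ w : Fin n → Bool, ∑ d ∈ n.divisors,
        if Function.minimalPeriod rotateOne w ∣ n / d ∧
          (Finset.univ.filter (fun i => w i = true)).card = k
        then ArithmeticFunction.moebius d else 0 := by
        refine Finset.sum_congr rfl fun w _ => ?_
        by_cases hw : (Finset.univ.filter (fun i => w i = true)).card = k
        · simp only [hw, and_true]
          rw [sum_moebius_dvd_div hn
            ((Function.isPeriodicPt_iff_minimalPeriod_dvd).mp (isPeriodicPt_rotateOne w)),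
            isAperiodic_iff_minimalPeriod]
          split_ifs <;> simp
        · simp [hw]
    _ = _ := by
        rw [Finset.sum_comm]
        refine Finset.sum_congr rfl fun d hd => ?_
        have hd' := Nat.dvd_of_mem_divisors hd
        obtain ⟨m, rfl⟩ := hd'
        have hd0 : 0 < d := Nat.pos_of_ne_zero (left_ne_zero_of_mul hn)
        rw [Nat.mul_div_cancel_left _ hd0, ← Finset.sum_filter, Finset.sum_const]
        have h2 := card_words_of_rotate_eq d m k
        simp only [← Function.isPeriodicPt_iff_minimalPeriod_dvd, Function.IsPeriodicPt,
          Function.IsFixedPt]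
        rw [h2]
        split_ifs <;> simp [mul_comm]

/-! ### The critical equations force constant coefficients -/

theorem ZMod.eq_of_forall_add_one_eq {n : ℕ} [NeZero n] {α : Type*} {F : ZMod n → α}
    (h : ∀ i, F (i + 1) = F i) (i j : ZMod n) : F i = F j := by
  have h1 : ∀ m : ℕ, F (m : ZMod n) = F 0 := by
    intro m
    induction m with
    | zero => simp
    | succ m ih => rw [Nat.cast_succ, h, ih]
  rw [← ZMod.natCast_zmod_val i, ← ZMod.natCast_zmod_val j, h1, h1]

/-- A multiplicative cocycle on `ℤ/n` with trivial total product is a coboundary. -/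
theorem ZMod.exists_add_one_eq_mul {n : ℕ} [NeZero n] {G : Type*} [CommGroup G] (u : ZMod n → G)
    (hu : ∏ i, u i = 1) : ∃ t : ZMod n → G, ∀ i, t (i + 1) = u i * t i := by
  have hn := Nat.pos_of_ne_zero (NeZero.ne n)
  have hprod : ∏ m ∈ Finset.range n, u (m : ZMod n) = 1 := by
    rw [← hu]
    refine Finset.prod_bij (fun m _ => (m : ZMod n)) (by simp) ?_ ?_ (by simp)
    · intro a ha b hb h
      have := congrArg ZMod.val h
      rwa [ZMod.val_cast_of_lt (Finset.mem_range.mp ha),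
        ZMod.val_cast_of_lt (Finset.mem_range.mp hb)] at this
    · intro i _
      exact ⟨i.val, Finset.mem_range.mpr (ZMod.val_lt i), ZMod.natCast_zmod_val i⟩
  refine ⟨fun i => ∏ m ∈ Finset.range i.val, u (m : ZMod n), fun i => ?_⟩
  have hi : (i + 1).val = (i.val + 1) % n := by
    conv_lhs => rw [← ZMod.natCast_zmod_val i]
    rw [← Nat.cast_succ, ZMod.val_natCast]
  have hs : u i * ∏ m ∈ Finset.range i.val, u (m : ZMod n) =
      ∏ m ∈ Finset.range (i.val + 1), u (m : ZMod n) := by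
    rw [Finset.prod_range_succ, ZMod.natCast_zmod_val, mul_comm]
  simp only [hi, hs]
  rcases Nat.lt_or_ge (i.val + 1) n with h | h
  · rw [Nat.mod_eq_of_lt h]
  · have h' : i.val + 1 = n := le_antisymm (ZMod.val_lt i) h
    rw [h', Nat.mod_self, hprod, Finset.prod_range_zero]

/-- `g i m` stands for the pairing of the functional `f i` with the column `i + m`. The recurrence
of the columns and the one of the functionals expand the same number `g i (K + 1 + s)` with the
coefficient `c _ (K - s)` taken at two consecutive places, the other terms being already known
to be independent of the place. -/
theorem coeff_const_of_recurrences {n : ℕ} [NeZero n] (K : ℕ) (c g : ZMod n → ℕ → ℂ)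
    (h0 : ∀ i m, m < K → g i m = 0) (h1 : ∀ i, g i K = 1)
    (hv : ∀ i (s : ℕ), s ≤ K →
      g i (K + 1 + s) = ∑ l ∈ Finset.range (K + 1), c (i + s) l * g i (l + s))
    (hf : ∀ i (s : ℕ), s ≤ K →
      g i (K + 1 + s) = ∑ l ∈ Finset.range (K + 1),
        c (i + (K + 1) - l) l * g (i + (K + 1) - l) (l + s)) :
    ∀ l ≤ K, ∀ i, c i l = c 0 l := by
  have key : ∀ s : ℕ, s ≤ K → (∀ i i', c i (K - s) = c i' (K - s)) ∧
      (∀ i i', g i (K + 1 + s) = g i' (K + 1 + s)) := by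
    intro s
    induction s using Nat.strong_induction_on with
    | _ s ih =>
      intro hs
      have hg : ∀ m, m < K + 1 + s → ∀ i i', g i m = g i' m := by
        intro m hm i i'
        rcases lt_trichotomy m K with h | h | h
        · rw [h0 i m h, h0 i' m h]
        · rw [h, h1, h1]
        · obtain ⟨s', rfl⟩ : ∃ s', m = K + 1 + s' := ⟨m - (K + 1), by omega⟩
          exact (ih s' (by omega) (by omega)).2 i i'
      have hc : ∀ l, K - s < l → l ≤ K → ∀ i i', c i l = c i' l := by
        intro l hl hl' i i'
        have := (ih (K - l) (by omega) (by omega)).1 i i'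
        rwa [show K - (K - l) = l by omega] at this
      have hstep : ∀ i, c (i + s) (K - s) = c (i + s + 1) (K - s) := by
        intro i
        have hmem : K - s ∈ Finset.range (K + 1) := Finset.mem_range.mpr (by omega)
        -- The terms with `l < K - s` vanish, those with `l > K - s` agree by induction, and the
        -- remaining one has the factor `g _ K = 1` on both sides.
        have h2 := (hv i s hs).symm.trans (hf i s hs)
        rw [← Finset.add_sum_erase _ _ hmem, ← Finset.add_sum_erase _ _ hmem] at h2
        have h3 : ∀ l ∈ (Finset.range (K + 1)).erase (K - s), c (i + s) l * g i (l + s) =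
            c (i + (K + 1) - l) l * g (i + (K + 1) - l) (l + s) := by
          intro l hl
          rw [Finset.mem_erase, Finset.mem_range] at hl
          rcases Nat.lt_or_ge l (K - s) with h | h
          · rw [h0 _ _ (by omega), h0 _ _ (by omega), mul_zero, mul_zero]
          · rw [hc l (by omega) (by omega) _ (i + (K + 1) - l),
              hg (l + s) (by omega) _ (i + (K + 1) - l)]
        rw [Finset.sum_congr rfl h3, add_left_inj, Nat.sub_add_cancel hs, h1, h1, mul_one,
          mul_one, Nat.cast_sub hs] at h2
        rw [h2]
        congr 1
        ring
      have hC : ∀ i i', c i (K - s) = c i' (K - s) := by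
        refine ZMod.eq_of_forall_add_one_eq (F := fun i => c i (K - s)) fun i => ?_
        have := hstep (i - s)
        simpa using this.symm
      refine ⟨hC, fun i i' => ?_⟩
      rw [hv i s hs, hv i' s hs]
      refine Finset.sum_congr rfl fun l hl => ?_
      rw [Finset.mem_range] at hl
      rw [hg (l + s) (by omega) i i']
      rcases lt_trichotomy l (K - s) with h | h | h
      · rw [h0 _ _ (by omega), mul_zero, mul_zero]
      · rw [h, hC _ (i' + s)]
      · rw [hc l h (by omega) _ (i' + s)]
  intro l hl i
  have := (key (K - l) (by omega)).1 i 0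
  rwa [show K - (K - l) = l by omega] at this

/-- Columns satisfying the critical equations can be rescaled so that they satisfy a linear
recurrence with constant coefficients. The scaling makes all leading coefficients `c i K` equal
to an `n`-th root `C` of their product. -/
theorem exists_scaling_recurrence {n K : ℕ} [NeZero n] (v f : ZMod n → Fin (K + 1) → ℂ)
    (c : ZMod n → ℕ → ℂ)
    (hv : ∀ i, v (i + (K + 1)) = ∑ l ∈ Finset.range (K + 1), c i l • v (i + l))
    (h0 : ∀ i, ∀ l : ℕ, l < K → f i ⬝ᵥ v (i + l) = 0) (h1 : ∀ i, f i ⬝ᵥ v (i + K) = 1)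
    (hx : ∀ i, c i K ≠ 0)
    (hf : ∀ j, (c (j - (K + 1)) K)⁻¹ • f (j - (K + 1)) =
      ∑ l ∈ Finset.range (K + 1), (c (j - l) l * (c (j - l) K)⁻¹) • f (j - l)) :
    ∃ (t : ZMod n → ℂˣ) (b : ℕ → ℂ), b K ≠ 0 ∧
      ∀ i, (t (i + (K + 1)) : ℂ) • v (i + (K + 1)) =
        ∑ l ∈ Finset.range (K + 1), b l • (t (i + l) : ℂ) • v (i + l) := by
  have hn := Nat.pos_of_ne_zero (NeZero.ne n)
  let x : ZMod n → ℂˣ := fun i => Units.mk0 (c i K) (hx i)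
  obtain ⟨C₀, hC₀⟩ := IsAlgClosed.exists_pow_nat_eq (∏ i, (x i : ℂ)) hn
  have hC0 : C₀ ≠ 0 := by
    rintro rfl
    rw [zero_pow hn.ne'] at hC₀
    exact Finset.prod_ne_zero_iff.mpr (fun i _ => (x i).ne_zero) hC₀.symm
  let C : ℂˣ := Units.mk0 C₀ hC0
  have hC : C ^ n = ∏ i, x i := by
    apply Units.ext
    push_cast
    exact hC₀
  obtain ⟨t, ht⟩ := ZMod.exists_add_one_eq_mul (fun i => C / x (i - (K : ZMod n))) (by
    rw [Finset.prod_div_distrib, Finset.prod_const, Finset.card_univ, ZMod.card, hC,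
      div_eq_one, ← (Equiv.subRight (K : ZMod n)).prod_comp x]
    rfl)
  have ht' : ∀ i, (t (i + (K + 1)) : ℂ) = C₀ * (c i K)⁻¹ * t (i + K) := by
    intro i
    rw [← add_assoc, ht]
    simp [C, x, div_eq_mul_inv]
  have htne : ∀ i, (t i : ℂ) ≠ 0 := fun i => (t i).ne_zero
  set c' : ZMod n → ℕ → ℂ := fun i l => t (i + (K + 1)) * (t (i + l) : ℂ)⁻¹ * c i l with hc'
  have hv' : ∀ i, (t (i + (K + 1)) : ℂ) • v (i + (K + 1)) =
      ∑ l ∈ Finset.range (K + 1), c' i l • (t (i + l) : ℂ) • v (i + l) := by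
    intro i
    rw [hv, Finset.smul_sum]
    refine Finset.sum_congr rfl fun l _ => ?_
    rw [smul_smul, smul_smul]
    congr 1
    simp only [hc']
    have := htne (i + l)
    field_simp
  -- The functionals scale inversely to the last column on which they are normalized.
  have hf' : ∀ j, (t (j - (K + 1) + K) : ℂ)⁻¹ • f (j - (K + 1)) =
      ∑ l ∈ Finset.range (K + 1), c' (j - l) l • (t (j - l + K) : ℂ)⁻¹ • f (j - l) := by
    intro j
    have e1 : (t (j - (K + 1) + K) : ℂ)⁻¹ = C₀ * (t j : ℂ)⁻¹ * (c (j - (K + 1)) K)⁻¹ := by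
      have h2 := ht' (j - (K + 1))
      rw [sub_add_cancel] at h2
      rw [h2]
      have := hx (j - (K + 1))
      have := htne (j - (K + 1) + K)
      field_simp
    rw [e1, mul_smul, hf, Finset.smul_sum]
    refine Finset.sum_congr rfl fun l _ => ?_
    rw [smul_smul, smul_smul]
    congr 1
    simp only [hc', ht', sub_add_cancel]
    have := hx (j - l)
    have := htne (j - l + K)
    field_simp
  have hconst := coeff_const_of_recurrences K c'
    (fun i m => ((t (i + K) : ℂ)⁻¹ • f i) ⬝ᵥ ((t (i + m) : ℂ) • v (i + m)))
    (fun i m hm => by simp [h0 i m hm])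
    (fun i => by simp [h1 i])
    (fun i s _ => by
      have e : i + ((K + 1 + s : ℕ) : ZMod n) = i + s + (K + 1) := by push_cast; ring
      simp only [e]
      rw [hv', dotProduct_sum]
      refine Finset.sum_congr rfl fun l _ => ?_
      have e2 : i + ((l + s : ℕ) : ZMod n) = i + s + l := by push_cast; ring
      rw [e2, dotProduct_smul, smul_eq_mul])
    (fun i s _ => by
      have h2 := hf' (i + (K + 1))
      rw [add_sub_cancel_right] at h2
      simp only [h2]
      rw [sum_dotProduct]
      refine Finset.sum_congr rfl fun l _ => ?_
      have e2 : i + (K + 1) - l + ((l + s : ℕ) : ZMod n) = i + ((K + 1 + s : ℕ) : ZMod n) := by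
        push_cast; ring
      rw [e2, smul_dotProduct, smul_eq_mul])
  refine ⟨t, c' 0, ?_, fun i => ?_⟩
  · simp only [hc']
    exact mul_ne_zero (mul_ne_zero (htne _) (inv_ne_zero (htne _))) (hx 0)
  · rw [hv']
    refine Finset.sum_congr rfl fun l hl => ?_
    rw [hconst l (Nat.lt_succ_iff.mp (Finset.mem_range.mp hl))]

/-! ### The differential of the potential -/

/-- Jacobi's formula along a line. -/
theorem Matrix.hasDerivAt_det_add_smul {m : Type*} [Fintype m] [DecidableEq m]
    (A D : Matrix m m ℂ) (hA : A.det ≠ 0) :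
    HasDerivAt (fun s : ℂ => (A + s • D).det) (A.det * (A⁻¹ * D).trace) 0 := by
  have hU : IsUnit A.det := isUnit_iff_ne_zero.mpr hA
  have h1 : ∀ s : ℂ, (A + s • D).det = A.det * (1 + (A⁻¹ * D).trace * s +
      (Matrix.det (1 + (Polynomial.X : Polynomial ℂ) • (A⁻¹ * D).map Polynomial.C)).divX.divX.eval s
        * s ^ 2) := by
    intro s
    rw [← Matrix.det_one_add_smul, ← Matrix.det_mul, mul_add, mul_one, Matrix.mul_smul,
      ← Matrix.mul_assoc, Matrix.mul_nonsing_inv _ hU, Matrix.one_mul]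
  simp only [h1]
  generalize (Matrix.det (1 + (Polynomial.X : Polynomial ℂ) •
    (A⁻¹ * D).map Polynomial.C)).divX.divX = R
  have h2 := ((((hasDerivAt_id (0 : ℂ)).const_mul (A⁻¹ * D).trace).const_add 1).add
    ((R.hasDerivAt 0).mul ((hasDerivAt_id (0 : ℂ)).pow 2))).const_mul A.det
  exact h2.congr_deriv (by simp)

theorem hasDerivAt_log_ratio {p q : ℂ → ℂ} {p₀ q₀ a b : ℂ} (hp : HasDerivAt p (p₀ * a) 0)
    (hq : HasDerivAt q (q₀ * b) 0) (hp0 : p 0 = p₀) (hq0 : q 0 = q₀) (hpn : p₀ ≠ 0)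
    (hqn : q₀ ≠ 0) : HasDerivAt (fun s => Complex.log (p s / q s / (p₀ / q₀))) (a - b) 0 := by
  have h1 := (hp.div hq (hq0 ▸ hqn)).div_const (p₀ / q₀)
  have h2 : p 0 / q 0 / (p₀ / q₀) = 1 := by
    rw [hp0, hq0]; exact div_self (div_ne_zero hpn hqn)
  have h3 := h1.clog (by
    change p 0 / q 0 / (p₀ / q₀) ∈ Complex.slitPlane
    rw [h2]; exact Complex.one_mem_slitPlane)
  refine h3.congr_deriv ?_
  rw [Pi.div_apply, h2, hp0, hq0]
  field_simp

/-- The square matrix of the columns `i, …, i + k - 1`. -/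
def consecMatrix {k n : ℕ} (M : PKMatrix k n) (i : ZMod n) : Matrix (Fin k) (Fin k) ℂ :=
  M.submatrix id (fun j : Fin k => i + ((j : ℕ) : ZMod n))

/-- The square matrix of the columns `i, …, i + k - 2, i + k`. -/
def skipMatrix {k n : ℕ} (M : PKMatrix k n) (i : ZMod n) : Matrix (Fin k) (Fin k) ℂ :=
  M.submatrix id (fun j : Fin k =>
    i + ((if (j : ℕ) + 1 = k then k else (j : ℕ) : ℕ) : ZMod n))

open scoped Matrix

/-- The functional of the dual basis of the columns `i, …, i + K` that belongs to the last one. -/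
noncomputable def lastDual {K n : ℕ} (M : PKMatrix (K + 1) n) (i : ZMod n) : Fin (K + 1) → ℂ :=
  (consecMatrix M i)⁻¹ (Fin.last K)

/-- The coefficient of the column `i + l` in the expansion of the column `i + (K + 1)` in the basis
of the columns `i, …, i + K`. -/
noncomputable def recCoeff {K n : ℕ} (M : PKMatrix (K + 1) n) (i : ZMod n) (l : ℕ) : ℂ :=
  ((consecMatrix M i)⁻¹ *ᵥ M.col (i + (K + 1))) (Fin.ofNat (K + 1) l)

section
variable {K n : ℕ} {M : PKMatrix (K + 1) n}

theorem consecInv_dotProduct_col (hM : InPKDomain M) (i : ZMod n) (l m : Fin (K + 1)) :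
    (consecMatrix M i)⁻¹ l ⬝ᵥ M.col (i + ((m : ℕ) : ZMod n)) = if l = m then 1 else 0 := by
  have hU : IsUnit (consecMatrix M i).det := isUnit_iff_ne_zero.mpr (hM i).1
  have := congrFun (congrFun (Matrix.nonsing_inv_mul _ hU) l) m
  rw [Matrix.one_apply, Matrix.mul_apply] at this
  exact this

theorem lastDual_dotProduct_of_lt (hM : InPKDomain M) (i : ZMod n) (l : ℕ) (hl : l < K) :
    lastDual M i ⬝ᵥ M.col (i + (l : ZMod n)) = 0 := by
  have := consecInv_dotProduct_col hM i (Fin.last K) ⟨l, by omega⟩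
  rw [if_neg (by simp [Fin.ext_iff]; omega)] at this
  exact this

theorem lastDual_dotProduct_self (hM : InPKDomain M) (i : ZMod n) :
    lastDual M i ⬝ᵥ M.col (i + (K : ZMod n)) = 1 := by
  have := consecInv_dotProduct_col hM i (Fin.last K) (Fin.last K)
  rw [if_pos rfl] at this
  exact this

theorem recCoeff_fin (i : ZMod n) (l : Fin (K + 1)) : recCoeff M i (l : ℕ) =
    (consecMatrix M i)⁻¹ l ⬝ᵥ M.col (i + (K + 1)) := by
  simp [recCoeff, Matrix.mulVec]

theorem recCoeff_last (i : ZMod n) : recCoeff M i K =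
    lastDual M i ⬝ᵥ M.col (i + (K + 1)) :=
  recCoeff_fin i (Fin.last K)

theorem col_eq_sum_recCoeff (hM : InPKDomain M) (i : ZMod n) : M.col (i + (K + 1)) =
    ∑ l ∈ Finset.range (K + 1), recCoeff M i l • M.col (i + (l : ZMod n)) := by
  have hU : IsUnit (consecMatrix M i).det := isUnit_iff_ne_zero.mpr (hM i).1
  have h1 : M.col (i + (K + 1)) =
      consecMatrix M i *ᵥ ((consecMatrix M i)⁻¹ *ᵥ M.col (i + (K + 1))) := by
    rw [Matrix.mulVec_mulVec, Matrix.mul_nonsing_inv _ hU, Matrix.one_mulVec]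
  rw [Finset.sum_range]
  refine h1.trans ?_
  ext a
  simp only [recCoeff_fin, Finset.sum_apply, Pi.smul_apply, smul_eq_mul]
  rw [Matrix.mulVec, dotProduct]
  exact Finset.sum_congr rfl fun l _ => mul_comm _ _

theorem recCoeff_last_ne_zero (hM : InPKDomain M) (i : ZMod n) : recCoeff M i K ≠ 0 := by
  intro h
  refine (hM i).2 (Matrix.exists_vecMul_eq_zero_iff.mp ⟨lastDual M i, fun h0 => ?_, ?_⟩)
  · have := lastDual_dotProduct_self hM i
    simp [h0] at this
  · ext l
    change lastDual M i ⬝ᵥ M.col (i + ((if (l : ℕ) + 1 = K + 1 then K + 1 else (l : ℕ) : ℕ))) = 0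
    split_ifs with hl
    · rw [recCoeff_last] at h
      simpa using h
    · exact lastDual_dotProduct_of_lt hM i l (by omega)

/-- The dual basis of the columns `i, …, i + K - 1, i + K + 1`, in terms of the one of the
columns `i, …, i + K`. -/
theorem skipMatrix_inv_apply (hM : InPKDomain M) (i : ZMod n) (l : Fin (K + 1)) :
    (skipMatrix M i)⁻¹ l = (consecMatrix M i)⁻¹ l -
      ((recCoeff M i l - if l = Fin.last K then 1 else 0) / recCoeff M i K) • lastDual M i := by
  have hx := recCoeff_last_ne_zero hM i
  rw [Matrix.inv_eq_left_inv (B := Matrix.of fun l => (consecMatrix M i)⁻¹ l -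
      ((recCoeff M i (l : ℕ) - if l = Fin.last K then 1 else 0) / recCoeff M i K) • lastDual M i)]
  · rfl
  · ext l m
    rw [Matrix.mul_apply']
    change ((consecMatrix M i)⁻¹ l - ((recCoeff M i (l : ℕ) - if l = Fin.last K then 1 else 0) /
      recCoeff M i K) • lastDual M i) ⬝ᵥ
      M.col (i + ((if (m : ℕ) + 1 = K + 1 then K + 1 else (m : ℕ) : ℕ))) = _
    rw [sub_dotProduct, smul_dotProduct, Matrix.one_apply, smul_eq_mul]
    by_cases hm : m = Fin.last K
    · subst hm
      simp only [Fin.val_last, if_true, Nat.cast_add, Nat.cast_one]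
      rw [← recCoeff_fin, ← recCoeff_last]
      field_simp
      ring
    · have hm' : (m : ℕ) < K := Fin.val_lt_last hm
      rw [if_neg (by omega), consecInv_dotProduct_col hM, lastDual_dotProduct_of_lt hM _ _ hm']
      simp

/-- The logarithmic derivative of `p_{i,…,i+k-1} / p_{i,…,i+k-2,i+k}` in the direction `D`. -/
theorem trace_consec_sub_trace_skip (hM : InPKDomain M) (D : PKMatrix (K + 1) n) (i : ZMod n) :
    ((consecMatrix M i)⁻¹ * consecMatrix D i).trace - ((skipMatrix M i)⁻¹ * skipMatrix D i).trace =
      (recCoeff M i K)⁻¹ * (∑ l ∈ Finset.range (K + 1),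
        recCoeff M i l * (lastDual M i ⬝ᵥ D.col (i + (l : ZMod n))) -
          lastDual M i ⬝ᵥ D.col (i + (K + 1))) := by
  have hx := recCoeff_last_ne_zero hM i
  have e1 : ((consecMatrix M i)⁻¹ * consecMatrix D i).trace =
      ∑ l : Fin (K + 1), (consecMatrix M i)⁻¹ l ⬝ᵥ D.col (i + ((l : ℕ) : ZMod n)) := rfl
  have e2 : ((skipMatrix M i)⁻¹ * skipMatrix D i).trace =
      ∑ l : Fin (K + 1), (skipMatrix M i)⁻¹ l ⬝ᵥ
        D.col (i + ((if (l : ℕ) + 1 = K + 1 then K + 1 else (l : ℕ) : ℕ))) := rfl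
  have e3 : ∀ l : Fin K, ((l.castSucc : Fin (K + 1)) : ℕ) + 1 ≠ K + 1 := fun l => by
    have := l.2; simp; omega
  rw [e1, e2, Fin.sum_univ_castSucc, Fin.sum_univ_castSucc, Finset.sum_range,
    Fin.sum_univ_castSucc]
  simp only [skipMatrix_inv_apply hM, if_neg (e3 _), Fin.val_last, if_true, sub_dotProduct,
    smul_dotProduct, smul_eq_mul, Finset.sum_sub_distrib, Nat.cast_add, Nat.cast_one,
    (Fin.castSucc_lt_last _).ne, if_false, sub_zero]
  simp only [show (consecMatrix M i)⁻¹ (Fin.last K) = lastDual M i from rfl, mul_sub, mul_add,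
    Finset.mul_sum]
  rw [Finset.sum_congr rfl (fun (l : Fin K) _ => show
    recCoeff M i (l.castSucc : ℕ) / recCoeff M i K * (lastDual M i ⬝ᵥ
      D.col (i + (((l.castSucc : Fin (K + 1)) : ℕ) : ZMod n))) =
    (recCoeff M i K)⁻¹ * (recCoeff M i (l.castSucc : ℕ) * (lastDual M i ⬝ᵥ
      D.col (i + (((l.castSucc : Fin (K + 1)) : ℕ) : ZMod n)))) by ring)]
  field_simp
  ring

theorem hasDerivAt_pkPotential [NeZero n] (hM : InPKDomain M) (D : PKMatrix (K + 1) n) :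
    HasDerivAt (fun s : ℂ => pkPotential M (M + s • D))
      (∑ i, (recCoeff M i K)⁻¹ * (∑ l ∈ Finset.range (K + 1),
        recCoeff M i l * (lastDual M i ⬝ᵥ D.col (i + (l : ZMod n))) -
          lastDual M i ⬝ᵥ D.col (i + (K + 1)))) 0 := by
  unfold pkPotential
  refine HasDerivAt.fun_sum fun i _ => HasDerivAt.const_add _ ?_
  rw [← trace_consec_sub_trace_skip hM]
  exact hasDerivAt_log_ratio
    (Matrix.hasDerivAt_det_add_smul (consecMatrix M i) (consecMatrix D i) (hM i).1)
    (Matrix.hasDerivAt_det_add_smul (skipMatrix M i) (skipMatrix D i) (hM i).2)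
    (by simp [consecMinor]) (by simp [skipMinor]) (hM i).1 (hM i).2

/-- The critical equations: perturbing only the column `j` yields one linear relation between
the functionals `lastDual M (j - l)`. -/
theorem IsPKCritical.lastDual_eq [NeZero n] (hM : IsPKCritical M) (j : ZMod n) :
    (recCoeff M (j - (K + 1)) K)⁻¹ • lastDual M (j - (K + 1)) =
      ∑ l ∈ Finset.range (K + 1), (recCoeff M (j - (l : ZMod n)) l *
        (recCoeff M (j - (l : ZMod n)) K)⁻¹) • lastDual M (j - (l : ZMod n)) := by
  obtain ⟨hD, hF⟩ := hM
  refine dotProduct_eq _ _ fun w => ?_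
  -- The perturbation replacing the column `j` by `v j + s • w`.
  let D : PKMatrix (K + 1) n := Matrix.of fun a m => if m = j then w a else 0
  have hDcol : ∀ (i : ZMod n) (u : Fin (K + 1) → ℂ),
      u ⬝ᵥ D.col i = if i = j then u ⬝ᵥ w else 0 := by
    intro i u
    by_cases h : i = j
    · simp only [h, if_true]
      congr 1
      ext a
      simp [D, Matrix.col]
    · rw [if_neg h]
      simp [D, Matrix.col, dotProduct, h]
  have hγ : HasDerivAt (fun s : ℂ => (fun a m => M a m + s * D a m : Fin (K + 1) → ZMod n → ℂ))
      (fun a m => D a m) 0 := by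
    refine hasDerivAt_pi.mpr fun a => hasDerivAt_pi.mpr fun m => ?_
    simpa using ((hasDerivAt_id (0 : ℂ)).mul_const (D a m)).const_add (M a m)
  have h1 := HasFDerivAt.comp_hasDerivAt_of_eq (0 : ℂ) hF hγ (by simp)
  have h2 := h1.unique (hasDerivAt_pkPotential hD D)
  simp only [zero_apply, hDcol, mul_sub, Finset.mul_sum,
    Finset.sum_sub_distrib] at h2
  rw [Finset.sum_comm] at h2
  simp only [← eq_sub_iff_add_eq, mul_ite, mul_zero, Finset.sum_ite_eq', Finset.mem_univ,
    if_true] at h2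
  rw [smul_dotProduct, sum_dotProduct, smul_eq_mul]
  refine (sub_eq_zero.mp h2.symm).symm.trans (Finset.sum_congr rfl fun l _ => ?_)
  rw [smul_dotProduct, smul_eq_mul]
  ring
end

/-! ### Matrices whose columns satisfy a recurrence with constant coefficients -/

open Polynomial

/-- The monic polynomial whose roots are the powers `ζ ^ i` with `w i = 1`. -/
noncomputable def wordPoly (ζ : ℂ) {n : ℕ} (w : Fin n → Bool) : ℂ[X] :=
  ∏ i ∈ Finset.univ.filter (fun i => w i = true), (X - C (ζ ^ (i : ℕ)))

theorem wordPoly_monic (ζ : ℂ) {n : ℕ} (w : Fin n → Bool) : (wordPoly ζ w).Monic :=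
  monic_prod_of_monic _ _ fun _ _ => monic_X_sub_C _

theorem wordPoly_natDegree (ζ : ℂ) {n : ℕ} (w : Fin n → Bool) :
    (wordPoly ζ w).natDegree = (Finset.univ.filter (fun i => w i = true)).card := by
  rw [wordPoly, natDegree_prod_of_monic _ _ fun _ _ => monic_X_sub_C _]
  simp only [natDegree_X_sub_C, Finset.sum_const, smul_eq_mul, mul_one]

/-- The sequence of vectors `v` satisfies the linear recurrence with characteristic polynomial
`P`. -/
def SatisfiesRec {n : ℕ} {V : Type*} [AddCommGroup V] [Module ℂ V] (P : ℂ[X])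
    (v : ZMod n → V) : Prop :=
  ∀ i, ∑ m ∈ Finset.range (P.natDegree + 1), P.coeff m • v (i + (m : ZMod n)) = 0

section
variable {V : Type*} [AddCommGroup V] [Module ℂ V]

/-- The linear map sending `X ^ m` to `v m`. -/
noncomputable def seqMap {n : ℕ} (v : ZMod n → V) : ℂ[X] →ₗ[ℂ] V :=
  (Polynomial.basisMonomials ℂ).constr ℂ (fun m : ℕ => v (m : ZMod n))

theorem seqMap_monomial {n : ℕ} (v : ZMod n → V) (m : ℕ) (a : ℂ) :
    seqMap v (monomial m a) = a • v (m : ZMod n) := by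
  have h : seqMap v (monomial m 1) = v (m : ZMod n) := by
    have := (Polynomial.basisMonomials ℂ).constr_basis ℂ (fun m : ℕ => v (m : ZMod n)) m
    rwa [Polynomial.coe_basisMonomials] at this
  rw [← h, ← map_smul, smul_monomial, smul_eq_mul, mul_one]

theorem SatisfiesRec.seqMap_mul {n : ℕ} {P : ℂ[X]} {v : ZMod n → V} (h : SatisfiesRec P v)
    (q : ℂ[X]) : seqMap v (P * q) = 0 := by
  induction q using Polynomial.induction_on' with
  | add p q hp hq => rw [mul_add, map_add, hp, hq, add_zero]
  | monomial m a =>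
    conv_lhs => rw [P.as_sum_range]
    rw [Finset.sum_mul, map_sum]
    have := congrArg (fun u => a • u) (h (m : ZMod n))
    simp only [smul_zero, Finset.smul_sum] at this
    rw [← this]
    refine Finset.sum_congr rfl fun l _ => ?_
    rw [monomial_mul_monomial, seqMap_monomial, smul_smul, mul_comm a, Nat.cast_add,
      add_comm (l : ZMod n)]

/-- The characteristic polynomial of a recurrence satisfied by an `n`-periodic sequence whose
initial terms are linearly independent divides `X ^ n - 1`. -/
theorem SatisfiesRec.dvd {n : ℕ} {P : ℂ[X]} {v : ZMod n → V} (h : SatisfiesRec P v)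
    (hP : P.Monic) (hP1 : P ≠ 1)
    (hv : LinearIndependent ℂ (fun l : Fin P.natDegree => v ((l : ℕ) : ZMod n))) :
    P ∣ X ^ n - 1 := by
  rw [← modByMonic_eq_zero_iff_dvd hP]
  -- The remainder yields a linear relation between the initial terms.
  set R := (X ^ n - 1 : ℂ[X]) %ₘ P with hR
  have hdeg : R.natDegree < P.natDegree := natDegree_modByMonic_lt _ hP hP1
  have h1 : seqMap v R = 0 := by
    have h2 : R = (X ^ n - 1) - P * ((X ^ n - 1) /ₘ P) := by
      rw [eq_sub_iff_add_eq]; exact modByMonic_add_div _ _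
    rw [h2, map_sub, h.seqMap_mul, sub_zero, map_sub, ← monomial_one_right_eq_X_pow,
      ← monomial_zero_one, seqMap_monomial, seqMap_monomial]
    simp
  rw [R.as_sum_range' _ hdeg, map_sum, Finset.sum_range] at h1
  simp only [seqMap_monomial] at h1
  have h3 := Fintype.linearIndependent_iff.mp hv (fun l => R.coeff l) h1
  ext m
  rcases Nat.lt_or_ge m P.natDegree with hm | hm
  · simpa using h3 ⟨m, hm⟩
  · rw [coeff_zero]; exact coeff_eq_zero_of_natDegree_lt (hdeg.trans_le hm)
end

/-- A monic divisor of `X ^ n - 1` is the product of the linear factors at a set of `n`-th roots of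
unity. -/
theorem exists_wordPoly_eq {n : ℕ} [NeZero n] {ζ : ℂ} (hζ : IsPrimitiveRoot ζ n) {P : ℂ[X]}
    (hP : P.Monic) (h : P ∣ X ^ n - 1) : ∃ w : Fin n → Bool, P = wordPoly ζ w := by
  classical
  have hn := Nat.pos_of_ne_zero (NeZero.ne n)
  have hne : (X ^ n - 1 : ℂ[X]) ≠ 0 := by
    simpa using X_pow_sub_C_ne_zero hn (1 : ℂ)
  refine ⟨fun i => decide (P.IsRoot (ζ ^ (i : ℕ))), ?_⟩
  have hnodup : P.roots.Nodup := by
    refine Multiset.nodup_of_le (roots.le_of_dvd hne h) ?_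
    have := hζ.nthRoots_one_nodup
    rwa [nthRoots, C_1] at this
  have hinj : ∀ i j : Fin n, ζ ^ (i : ℕ) = ζ ^ (j : ℕ) → i = j := fun i j hij =>
    Fin.ext (hζ.pow_inj i.2 j.2 hij)
  have hroots : P.roots.toFinset = (Finset.univ.filter
      (fun i : Fin n => P.IsRoot (ζ ^ (i : ℕ)))).image (fun i : Fin n => ζ ^ (i : ℕ)) := by
    ext z
    simp only [Multiset.mem_toFinset, mem_roots hP.ne_zero, Finset.mem_image, Finset.mem_filter,
      Finset.mem_univ, true_and]
    constructor
    · intro hz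
      have hz1 : z ^ n = 1 := by
        have := hz.dvd h
        simpa [IsRoot, sub_eq_zero] using this
      obtain ⟨i, hi, rfl⟩ := hζ.eq_pow_of_pow_eq_one hz1
      exact ⟨⟨i, hi⟩, hz, rfl⟩
    · rintro ⟨i, hi, rfl⟩
      exact hi
  conv_lhs => rw [(IsAlgClosed.splits P).eq_prod_roots_of_monic hP]
  have h2 : (P.roots.map (fun a => X - C a)).prod = ∏ a ∈ P.roots.toFinset, (X - C a) := by
    rw [Finset.prod_multiset_map_count]
    refine Finset.prod_congr rfl fun a ha => ?_
    rw [Multiset.count_eq_one_of_mem hnodup (Multiset.mem_toFinset.mp ha), pow_one]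
  rw [h2, hroots, Finset.prod_image (fun i _ j _ hij => hinj i j hij), wordPoly]
  simp

/-- The word of a polynomial with nonzero subleading coefficient is aperiodic: a rotation fixing
the word multiplies the sum of the roots by a nontrivial root of unity. -/
theorem isAperiodic_of_nextCoeff_ne_zero {n : ℕ} [NeZero n] {ζ : ℂ} (hζ : IsPrimitiveRoot ζ n)
    {w : Fin n → Bool} (h : (wordPoly ζ w).nextCoeff ≠ 0) : IsAperiodic w := by
  intro r hr hw
  apply h
  rw [wordPoly, prod_X_sub_C_nextCoeff, neg_eq_zero]
  have h1 : ∑ i ∈ Finset.univ.filter (fun i => w i = true), ζ ^ (i : ℕ) =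
      ζ ^ (r : ℕ) * ∑ i ∈ Finset.univ.filter (fun i => w i = true), ζ ^ (i : ℕ) := by
    rw [Finset.mul_sum]
    symm
    refine Finset.sum_equiv (Equiv.addRight r) (fun i => ?_) (fun i _ => ?_)
    · have := congrFun hw i
      simp [← this]
    · rw [Equiv.coe_addRight, Fin.val_add, ← pow_eq_pow_mod _ hζ.pow_eq_one, pow_add, mul_comm]
  have h2 : ζ ^ (r : ℕ) ≠ 1 := fun h3 => hr (Fin.ext (by
    simpa using hζ.pow_inj r.2 (Nat.pos_of_ne_zero (NeZero.ne n)) (by simpa using h3)))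
  have h3 : (ζ ^ (r : ℕ) - 1) *
      ∑ i ∈ Finset.univ.filter (fun i => w i = true), ζ ^ (i : ℕ) = 0 := by
    rw [sub_mul, one_mul, ← h1, sub_self]
  exact (mul_eq_zero.mp h3).resolve_left (sub_ne_zero.mpr h2)

theorem wordPoly_rotate {n : ℕ} [NeZero n] {ζ : ℂ} (hζ : IsPrimitiveRoot ζ n)
    (w : Fin n → Bool) (r : Fin n) :
    C (ζ ^ (r : ℕ)) ^ (Finset.univ.filter (fun i => w i = true)).card *
      wordPoly ζ (fun i => w (i + r)) = (wordPoly ζ w).comp (C (ζ ^ (r : ℕ)) * X) := by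
  have h1 : wordPoly ζ w = ∏ i ∈ Finset.univ.filter (fun i => w (i + r) = true),
      (X - C (ζ ^ ((i + r : Fin n) : ℕ))) := by
    rw [wordPoly]
    symm
    exact Finset.prod_equiv (Equiv.addRight r) (by simp) (fun i _ => rfl)
  have h2 : (Finset.univ.filter (fun i => w i = true)).card =
      (Finset.univ.filter (fun i => w (i + r) = true)).card :=
    (card_true_comp_equiv (Equiv.addRight r) w).symm
  rw [h2, h1, prod_comp, wordPoly, ← Finset.prod_const,
    ← Finset.prod_mul_distrib]
  refine Finset.prod_congr rfl fun i _ => ?_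
  rw [Fin.val_add, ← pow_eq_pow_mod _ hζ.pow_eq_one, pow_add]
  rw [sub_comp, X_comp, C_comp, C_mul]
  ring

/-- Rotating the word amounts to rescaling the columns by powers of a root of unity. -/
theorem exists_scaling_rotate {n : ℕ} [NeZero n] {V : Type*} [AddCommGroup V] [Module ℂ V] {ζ : ℂ}
    (hζ : IsPrimitiveRoot ζ n) {w : Fin n → Bool} (r : Fin n) {v : ZMod n → V}
    (h : SatisfiesRec (wordPoly ζ w) v) : ∃ t : ZMod n → ℂˣ,
      SatisfiesRec (wordPoly ζ (fun i => w (i + r))) (fun j => (t j : ℂ) • v j) := by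
  have hn := NeZero.ne n
  have hz0 : ζ ^ (r : ℕ) ≠ 0 := pow_ne_zero _ (hζ.ne_zero hn)
  let ω : ℂˣ := Units.mk0 _ hz0
  have hω : ω⁻¹ ^ n = 1 := by
    rw [inv_pow, inv_eq_one]
    apply Units.ext
    simp [ω, ← pow_mul, mul_comm _ n, pow_mul ζ n, hζ.pow_eq_one]
  refine ⟨fun j => ω⁻¹ ^ j.val, fun i => ?_⟩
  have hdeg : (wordPoly ζ (fun i => w (i + r))).natDegree = (wordPoly ζ w).natDegree := by
    rw [wordPoly_natDegree, wordPoly_natDegree]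
    exact card_true_comp_equiv (Equiv.addRight r) w
  have ht : ∀ m : ℕ, ω⁻¹ ^ (i + (m : ZMod n)).val = ω⁻¹ ^ i.val * ω⁻¹ ^ m := by
    intro m
    rw [ZMod.val_add, ZMod.val_natCast, Nat.add_mod_mod, ← pow_eq_pow_mod _ hω, pow_add]
  have hcoeff : ∀ m : ℕ, (wordPoly ζ (fun i => w (i + r))).coeff m =
      ((ω : ℂ) ^ (Finset.univ.filter (fun i => w i = true)).card)⁻¹ *
        ((wordPoly ζ w).coeff m * (ω : ℂ) ^ m) := by
    intro m
    have h1 := congrArg (fun p => p.coeff m) (wordPoly_rotate hζ w r)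
    simp only [comp_C_mul_X_coeff, ← C_pow, coeff_C_mul] at h1
    rw [eq_inv_mul_iff_mul_eq₀ (pow_ne_zero _ ω.ne_zero)]
    exact h1
  have h2 := congrArg (fun u => (((ω : ℂ) ^ (Finset.univ.filter (fun i => w i = true)).card)⁻¹ *
    ((ω⁻¹ ^ i.val : ℂˣ) : ℂ)) • u) (h i)
  simp only [smul_zero, Finset.smul_sum] at h2
  rw [hdeg, ← h2]
  refine Finset.sum_congr rfl fun m _ => ?_
  simp only [ht, hcoeff, smul_smul]
  congr 1
  push_cast
  have := ω.ne_zero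
  rw [inv_pow (ω : ℂ) m]
  field_simp

/-- Two matrices whose columns satisfy the same recurrence of order `k` differ by a change of
basis, given by their first `k` columns. -/
theorem pkEquiv_of_satisfiesRec {k n : ℕ} [NeZero n] (hk : k ≠ 0) {P : ℂ[X]} (hP : P.Monic)
    (hdeg : P.natDegree = k) {M N : PKMatrix k n} (hM : SatisfiesRec P M.col)
    (hN : SatisfiesRec P N.col) (hM0 : consecMinor M 0 ≠ 0) (hN0 : consecMinor N 0 ≠ 0) :
    pkEquiv M N := by
  have hU : IsUnit (consecMatrix M 0).det := isUnit_iff_ne_zero.mpr hM0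
  set g := consecMatrix N 0 * (consecMatrix M 0)⁻¹ with hg
  have hg1 : g * consecMatrix M 0 = consecMatrix N 0 := by
    rw [hg, Matrix.mul_assoc, Matrix.nonsing_inv_mul _ hU, Matrix.mul_one]
  have hgdet : g.det ≠ 0 := by
    intro h0
    apply hN0
    change (consecMatrix N 0).det = 0
    rw [← hg1, Matrix.det_mul, h0, zero_mul]
  have hcol : ∀ m : ℕ, N.col (m : ZMod n) = g *ᵥ M.col (m : ZMod n) := by
    intro m
    induction m using Nat.strong_induction_on with
    | _ m ih =>
      rcases Nat.lt_or_ge m k with hm | hm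
      · ext a
        have := congrFun (congrFun hg1 a) ⟨m, hm⟩
        simp only [consecMatrix, Matrix.mul_apply, Matrix.submatrix_apply, zero_add, id] at this
        exact this.symm
      · obtain ⟨s, rfl⟩ := Nat.exists_eq_add_of_le' hm
        have h1 := hM (s : ZMod n)
        have h2 := hN (s : ZMod n)
        have hlead : P.coeff k = 1 := hdeg ▸ hP.coeff_natDegree
        rw [hdeg, Finset.sum_range_succ, hlead, one_smul, add_comm] at h1 h2
        rw [Nat.cast_add, eq_neg_of_add_eq_zero_left h1, eq_neg_of_add_eq_zero_left h2,
          Matrix.mulVec_neg, Matrix.mulVec_sum]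
        congr 1
        refine Finset.sum_congr rfl fun l hl => ?_
        have := ih (s + l) (by have := Finset.mem_range.mp hl; omega)
        rw [Nat.cast_add] at this
        rw [Matrix.mulVec_smul, this]
  have hNM : N = g * M := by
    ext a j
    have := congrFun (hcol j.val) a
    rw [ZMod.natCast_zmod_val] at this
    exact this
  -- A `k`-th root of the determinant moves from `GL` to `SL`, at the price of a scalar.
  obtain ⟨y, hy⟩ := IsAlgClosed.exists_pow_nat_eq g.det (Nat.pos_of_ne_zero hk)
  have hy0 : y ≠ 0 := by
    rintro rfl
    exact hgdet (by rw [← hy, zero_pow hk])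
  refine ⟨⟨y⁻¹ • g, ?_⟩, fun _ => Units.mk0 y hy0, ?_⟩
  · rw [Matrix.det_smul, Fintype.card_fin, inv_pow, hy, inv_mul_cancel₀ hgdet]
  · ext a j
    simp only [Units.val_mk0, Matrix.mul_diagonal, Matrix.smul_mul, Matrix.smul_apply, ← hNM,
      smul_eq_mul]
    field_simp

/-! ### Critical points and Lyndon words -/

theorem consecMinor_mul_diagonal {k n : ℕ} [NeZero n] (M : PKMatrix k n) (t : ZMod n → ℂˣ)
    (i : ZMod n) (h : consecMinor M i ≠ 0) :
    consecMinor (M * Matrix.diagonal (fun j => (t j : ℂ))) i ≠ 0 := by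
  have : consecMinor (M * Matrix.diagonal (fun j => (t j : ℂ))) i =
      (∏ j : Fin k, (t (i + ((j : ℕ) : ZMod n)) : ℂ)) * consecMinor M i := by
    rw [consecMinor, consecMinor, ← Matrix.det_mul_row]
    congr 1
    ext a j
    simp [Matrix.mul_diagonal, mul_comm]
  rw [this]
  exact mul_ne_zero (Finset.prod_ne_zero_iff.mpr fun j _ => (t _).ne_zero) h

theorem col_mul_diagonal {k n : ℕ} [NeZero n] (M : PKMatrix k n) (t : ZMod n → ℂˣ) :
    (M * Matrix.diagonal (fun j => (t j : ℂ))).col = fun j => (t j : ℂ) • M.col j := by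
  ext j a
  simp [Matrix.col, Matrix.mul_diagonal, mul_comm]

theorem linearIndependent_col {k n : ℕ} {M : PKMatrix k n} (h : consecMinor M 0 ≠ 0) :
    LinearIndependent ℂ (fun l : Fin k => M.col ((l : ℕ) : ZMod n)) := by
  have h1 := Matrix.linearIndependent_cols_of_det_ne_zero (A := consecMatrix M 0) h
  have h2 : (consecMatrix M 0).col = fun l : Fin k => M.col ((l : ℕ) : ZMod n) := by
    ext l a
    simp [consecMatrix, Matrix.col]
  rwa [h2] at h1

/-- After rescaling, the columns of a critical matrix satisfy the linear recurrence attached to an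
aperiodic word. -/
theorem IsPKCritical.exists_aperiodic {K n : ℕ} [NeZero n] {M : PKMatrix (K + 1) n}
    (hM : IsPKCritical M) {ζ : ℂ} (hζ : IsPrimitiveRoot ζ n) :
    ∃ (t : ZMod n → ℂˣ) (w : Fin n → Bool), IsAperiodic w ∧
      (Finset.univ.filter (fun i => w i = true)).card = K + 1 ∧
      SatisfiesRec (wordPoly ζ w) (fun j => (t j : ℂ) • M.col j) := by
  obtain ⟨t, b, hb, hrec⟩ := exists_scaling_recurrence M.col (lastDual M) (recCoeff M)
    (col_eq_sum_recCoeff hM.1) (lastDual_dotProduct_of_lt hM.1) (lastDual_dotProduct_self hM.1)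
    (recCoeff_last_ne_zero hM.1) hM.lastDual_eq
  set Q : ℂ[X] := ∑ l ∈ Finset.range (K + 1), C (b l) * X ^ l with hQ
  have hQcoeff : ∀ l, Q.coeff l = if l < K + 1 then b l else 0 := by
    intro l
    simp [hQ, finsetSum_coeff, coeff_C_mul, coeff_X_pow]
  have hQdeg : Q.degree < ((K + 1 : ℕ) : WithBot ℕ) := by
    rw [degree_lt_iff_coeff_zero]
    intro m hm
    rw [hQcoeff, if_neg (by omega)]
  have hPm : (X ^ (K + 1) - Q).Monic := monic_X_pow_sub hQdeg
  have hPd : (X ^ (K + 1) - Q).natDegree = K + 1 := by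
    apply natDegree_eq_of_degree_eq_some
    rw [degree_sub_eq_left_of_degree_lt (by rwa [degree_X_pow]), degree_X_pow]
  have hsat : SatisfiesRec (X ^ (K + 1) - Q) (fun j => (t j : ℂ) • M.col j) := by
    intro i
    rw [hPd, Finset.sum_range_succ, ← sub_neg_eq_add, sub_eq_zero]
    simp only [coeff_sub, coeff_X_pow, hQcoeff, lt_irrefl, if_true, if_false, sub_zero, one_smul,
      Nat.cast_add, Nat.cast_one]
    rw [hrec i, ← Finset.sum_neg_distrib]
    refine Finset.sum_congr rfl fun l hl => ?_
    have hl' := Finset.mem_range.mp hl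
    rw [if_neg hl'.ne, if_pos hl', zero_sub, neg_smul]
  have hdvd : X ^ (K + 1) - Q ∣ X ^ n - 1 := by
    refine hsat.dvd hPm (fun h => ?_) ?_
    · rw [h, natDegree_one] at hPd
      omega
    · rw [hPd]
      have := linearIndependent_col (consecMinor_mul_diagonal M t 0 (hM.1 0).1)
      rwa [col_mul_diagonal] at this
  obtain ⟨w, hw⟩ := exists_wordPoly_eq hζ hPm hdvd
  refine ⟨t, w, isAperiodic_of_nextCoeff_ne_zero hζ ?_, ?_, hw ▸ hsat⟩
  · rw [← hw, nextCoeff_of_natDegree_pos (by omega), hPd, Nat.add_sub_cancel, coeff_sub,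
      coeff_X_pow, hQcoeff, if_neg (by omega), if_pos (by omega), zero_sub]
    exact neg_ne_zero.mpr hb
  · rw [← wordPoly_natDegree ζ, ← hw, hPd]

theorem pkEquiv_mul_diagonal {k n : ℕ} [NeZero n] (M : PKMatrix k n) (t : ZMod n → ℂˣ) :
    pkEquiv M (M * Matrix.diagonal (fun j => (t j : ℂ))) :=
  ⟨1, t, by simp⟩

/-- The configuration `x` is the cyclically symmetric configuration of the word `w`: the columns
of a representing matrix satisfy, after rescaling, the recurrence with characteristic polynomial
`wordPoly ζ w`. -/
def HasWord {k n : ℕ} [NeZero n] (ζ : ℂ) (x : ConfigSpace k n) (w : Fin n → Bool) : Prop :=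
  ∃ M : PKRep k n, (Quotient.mk (pkSetoid k n) M : ConfigSpace k n) = x ∧ consecMinor M.1 0 ≠ 0 ∧
    ∃ t : ZMod n → ℂˣ, SatisfiesRec (wordPoly ζ w) (fun j => (t j : ℂ) • M.1.col j)

theorem HasWord.eq {k n : ℕ} [NeZero n] (hk : k ≠ 0) {ζ : ℂ} {x y : ConfigSpace k n}
    {w : Fin n → Bool} (hw : (Finset.univ.filter (fun i => w i = true)).card = k)
    (hx : HasWord ζ x w) (hy : HasWord ζ y w) : x = y := by
  obtain ⟨M, rfl, hM, t, ht⟩ := hx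
  obtain ⟨N, rfl, hN, s, hs⟩ := hy
  rw [← col_mul_diagonal] at ht hs
  have h := pkEquiv_of_satisfiesRec hk (wordPoly_monic ζ w) ((wordPoly_natDegree ζ w).trans hw)
    ht hs (consecMinor_mul_diagonal _ t 0 hM) (consecMinor_mul_diagonal _ s 0 hN)
  exact Quotient.sound (pkEquiv_equivalence.trans (pkEquiv_mul_diagonal M.1 t)
    (pkEquiv_equivalence.trans h (pkEquiv_equivalence.symm (pkEquiv_mul_diagonal N.1 s))))

theorem exists_lyndon_hasWord {k n : ℕ} [NeZero n] (hk : k ≠ 0) {ζ : ℂ}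
    (hζ : IsPrimitiveRoot ζ n) {x : ConfigSpace k n} (hx : x ∈ pkCriticalPoints k n) :
    ∃ w : Fin n → Bool, (IsLyndon w ∧ (Finset.univ.filter (fun i => w i = true)).card = k) ∧
      HasWord ζ x w := by
  obtain ⟨K, rfl⟩ := Nat.exists_eq_succ_of_ne_zero hk
  obtain ⟨M, rfl, hM⟩ := hx
  obtain ⟨t, w, hw, hcard, hrec⟩ := hM.exists_aperiodic hζ
  obtain ⟨r, hr⟩ := hw.exists_isLyndon_rotate
  obtain ⟨s, hs⟩ := exists_scaling_rotate hζ r hrec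
  refine ⟨_, ⟨hr, (card_true_comp_equiv (Equiv.addRight r) w).trans hcard⟩, M, rfl, (hM.1 0).1,
    s * t, ?_⟩
  simpa only [Pi.mul_apply, Units.val_mul, mul_smul] using hs

theorem mainTheorem2 (k n : ℕ) [NeZero n] (hk : 2 ≤ k) (hkn : k + 2 ≤ n) :
    (pkCriticalPoints k n).Finite ∧
    (pkCriticalPoints k n).ncard ≤ lyndonCount k n ∧
    (lyndonCount k n : ℚ) = (1 / (n : ℚ)) * ∑ d ∈ (Nat.gcd k n).divisors,
      (ArithmeticFunction.moebius d : ℚ) * (Nat.choose (n / d) (k / d) : ℚ) := by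
  have hn := NeZero.ne n
  have hk0 : k ≠ 0 := by omega
  have hζ := Complex.isPrimitiveRoot_exp n hn
  have hex := fun (x : ConfigSpace k n) (hx : x ∈ pkCriticalPoints k n) =>
    exists_lyndon_hasWord hk0 hζ hx
  choose! W hW hxW using hex
  have hmaps : Set.MapsTo W (pkCriticalPoints k n)
      {w : Fin n → Bool | IsLyndon w ∧ (Finset.univ.filter (fun i => w i = true)).card = k} := hW
  have hinj : Set.InjOn W (pkCriticalPoints k n) := fun x hx y hy hxy =>
    HasWord.eq hk0 (hW x hx).2 (hxW x hx) (hxy ▸ hxW y hy)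
  refine ⟨Set.Finite.of_injOn hmaps hinj (Set.toFinite _),
    Set.ncard_le_ncard_of_injOn W hmaps hinj (Set.toFinite _), ?_⟩
  have h1 := congrArg (Int.cast : ℤ → ℚ) (mul_lyndonCount k n hk0)
  push_cast at h1
  have hn' : (n : ℚ) ≠ 0 := Nat.cast_ne_zero.mpr hn
  rw [← h1]
  field_simp
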